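/- Let $n,d$ be positive integers and let $\Delta^{n-1}=\{x\in\mathbb{R}^n : x_i\ge 0,\ x_1+\dots+x_n=1\}$. A partition of $\mathbb{R}^d$ into $n$ parts is an $n$-tuple $(C_1,\dots,C_n)$ of Lebesgue measurable sets with union $\mathbb{R}^d$ and with pairwise disjoint interiors (parts may be empty). A set $\mathcal{B}$ of such partitions is called a $\Delta$-space if there is a function $R:\Delta^{n-1}\to\mathcal{B}$, written $R(x)=(C_1(x),\dots,C_n(x))$, such that (1) for all $x\in\Delta^{n-1}$ and $i\in[n]$, if $x_i=0$ then $C_i(x)$ has Lebesgue measure zero, and (2) for every finite measure $\mu$ on $\mathbb{R}^d$ that is absolutely continuous with respect to Lebesgue measure and every $j\in[n]$, the function $x\mapsto\mu(C_j(x))$ is continuous on $\Delta^{n-1}$. A partition $(C_1,\dots,C_n)$ is envy-free for measures $\mu_1,\dots,\mu_n$ if there is a permutation $\pi$ of $[n]$ with $\mu_i(C_{\pi(i)})\ge\mu_i(C_{\pi(i')})$ for all $i,i'\in[n]$. **Theorem.** Let $\mathcal{B}$ be a $\Delta$-space of partitions of $\mathbb{R}^d$ into $n$ parts, and let $\mu_1,\dots,\mu_n$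 be probability measures on $\mathbb{R}^d$ that are absolutely continuous with respect to Lebesgue measure. Then $\mathcal{B}$ contains a partition that is envy-free for $\mu_1,\dots,\mu_n$. Moreover, the partition can be found without access to $\mu_n$: given only $\mu_1,\dots,\mu_{n-1}$, there is a partition in $\mathcal{B}$ that is envy-free for $\mu_1,\dots,\mu_{n-1},\mu_n$ for every absolutely continuous probability measure $\mu_n$ on $\mathbb{R}^d$. -/

import Mathlib

open MeasureTheory

/-- `(C_1, …, C_n)` is a partition of `ℝ^d` into `n` parts in the sense usual for mass partitions:
the parts are Lebesgue measurable sets whose union is `ℝ^d` and whose interiors are pairwise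
disjoint. Parts may be empty, and neither closedness nor convexity is required. -/
structure IsSpacePartition {d n : ℕ} (C : Fin n → Set (EuclideanSpace ℝ (Fin d))) : Prop where
  nullMeasurableSet : ∀ i, NullMeasurableSet (C i) volume
  iUnion_eq : ⋃ i, C i = Set.univ
  disjoint_interior : ∀ i j, i ≠ j → Disjoint (interior (C i)) (interior (C j))

/-- A set `B` of partitions of `ℝ^d` into `n` parts is a `Δ`-space if there is a function `R` from
the simplex `Δ^{n-1} = {x ∈ ℝ^n : x_i ≥ 0, ∑ x_i = 1}` to `B` such that the `i`-th part of `R x` is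
Lebesgue null whenever `x_i = 0`, and the measure of each part of `R x` depends continuously on `x`,
for every finite measure that is absolutely continuous with respect to Lebesgue measure. -/
structure IsDeltaSpace {d n : ℕ} (B : Set (Fin n → Set (EuclideanSpace ℝ (Fin d)))) : Prop where
  isSpacePartition : ∀ C ∈ B, IsSpacePartition C
  exists_parametrization : ∃ R : stdSimplex ℝ (Fin n) → Fin n → Set (EuclideanSpace ℝ (Fin d)),
    (∀ x, R x ∈ B) ∧
    (∀ x : stdSimplex ℝ (Fin n), ∀ i, x.1 i = 0 → volume (R x i) = 0) ∧
    (∀ μ : Measure (EuclideanSpace ℝ (Fin d)), IsFiniteMeasure μ → μ ≪ volume →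
      ∀ j, Continuous fun x => (μ (R x j)).toReal)

/-- `(C_1, …, C_n)` is envy-free for `μ_1, …, μ_n`: the parts can be assigned to the measures by a
permutation `π` in such a way that every measure gets a part that is maximal for it. -/
def IsEnvyFree {d n : ℕ} (C : Fin n → Set (EuclideanSpace ℝ (Fin d)))
    (μ : Fin n → Measure (EuclideanSpace ℝ (Fin d))) : Prop :=
  ∃ π : Equiv.Perm (Fin n), ∀ i i', μ i (C (π i')) ≤ μ i (C (π i))

/-!
The values `νᵢ(Cⱼ(x))` are continuous functions of `x` in the simplex which vanish where `xⱼ = 0`, and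
every `νᵢ` gives a positive value to some part. The claim is a statement about such functions
(`exists_forall_exists_injective_isMax`): with `n - 1` agents and `n` pieces there is a point `x` at
which, whichever piece is removed, the agents can be assigned distinct remaining pieces, each of them
one that is maximal for the agent among all `n` pieces. At this `x` the missing measure chooses its
favourite part and the other measures share the rest
(`isEnvyFree_of_forall_exists_injective`).

To find `x`, let each agent distribute a unit weight over the pieces whose value exceeds `t < 1` times
the maximum, with weights depending continuously on `x`. No weight goes to a piece with `xⱼ = 0`, so
the average over the agents is a continuous map of the simplex to itself which preserves all faces.
Such a map is surjective (`exists_eq_of_maps_facets`). At a preimage of the barycenter every piece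
receives the total weight `(n - 1) / n < 1`, so any nonempty set of `k` agents puts its weight on at
least `k + 1` pieces, and Hall's theorem gives the assignments after removal of any one piece
(`exists_injective_pos_of_sum_eq`). Then `t` tends to `1`; the simplex is compact and there are only
finitely many assignments.

Surjectivity of face-preserving maps is derived from a combinatorial lemma of Scarf
(`exists_isDominant_forall_color`), in the role usually played by Sperner's lemma. It concerns
several linear orders on a finite set of coloured points, and its proof by a parity count needs no
triangulation. Applied to the coordinate orders on the lattice points of a dilated simplex it produces
nearby points with the colours of a face (`exists_lattice_point_near_colors`).
-/

/-! ### Dominated sets for a family of linear orders -/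

section Scarf

variable {T ι α : Type*} [LinearOrder α]

/-- A finite set `σ` is dominant for the family of linear orders pulled back along the injective
functions `r i : T → α` if no element of `T` lies, for every `i`, strictly above some element of `σ`
with respect to the `i`-th order, that is, strictly above the `i`-th minimum of `σ`. -/
def IsDominant (r : ι → T → α) (σ : Finset T) : Prop :=
  ∀ y, ∃ i, ∀ x ∈ σ, r i y ≤ r i x

theorem IsDominant.mono {r : ι → T → α} {σ τ : Finset T} (h : IsDominant r σ) (hτ : τ ⊆ σ) :
    IsDominant r τ := fun y => (h y).imp fun _ hi x hx => hi x (hτ hx)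

/-- Each element of a dominant set is the minimum of the set for one of the orders. With one element
fewer than there are orders, exactly two orders `k`, `k'` share their minimum, and a new element
keeping the set dominant has to become the minimum for `k` or for `k'`. In either case it is the
greatest element, for that order, among those lying above the minima of all other orders. -/
theorem IsDominant.card_completions_eq_two [Fintype T] [DecidableEq T] [Fintype ι] [DecidableEq ι]
    {r : ι → T → α} (hr : ∀ i, Function.Injective (r i)) {τ : Finset T} (hne : τ.Nonempty)
    (hτ : IsDominant r τ) (hcard : τ.card + 1 = Fintype.card ι)
    (hM : ∀ k, ∃ y, ∀ j, j ≠ k → ∃ z ∈ τ, r j z < r j y)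
    [DecidablePred fun x => x ∉ τ ∧ IsDominant r (insert x τ)] :
    (Finset.univ.filter fun x => x ∉ τ ∧ IsDominant r (insert x τ)).card = 2 := by
  classical
  choose m hmτ hm using fun i => τ.exists_min_image (r i) hne
  have hsurj : ∀ z ∈ τ, ∃ i, m i = z := fun z hz => by
    obtain ⟨i, hi⟩ := hτ z
    exact ⟨i, hr i (le_antisymm (hm i z hz) (hi _ (hmτ i)))⟩
  -- Omitting an order without losing any minimum leaves a bijection onto `τ`.
  have hinj : ∀ k, (∀ z ∈ τ, ∃ i, i ≠ k ∧ m i = z) → ∀ i j, i ≠ k → j ≠ k → m i = m j → i = j := by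
    intro k hk i j hi hj hij
    have himg : (Finset.univ.erase k).image m = τ := by
      ext z
      simp only [Finset.mem_image, Finset.mem_erase, Finset.mem_univ, and_true]
      exact ⟨fun ⟨i, _, h⟩ => h ▸ hmτ i, hk z⟩
    have hc : ((Finset.univ.erase k).image m).card = (Finset.univ.erase k).card := by
      rw [himg, Finset.card_erase_of_mem (Finset.mem_univ _), Finset.card_univ]; omega
    exact Finset.card_image_iff.mp hc (by simpa using hi) (by simpa using hj) hij
  obtain ⟨k, k', hkk, hmk⟩ : ∃ k k', k ≠ k' ∧ m k = m k' := by
    obtain ⟨k, -, k', -, h, h'⟩ := Finset.exists_ne_map_eq_of_card_lt_of_maps_to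
      (s := Finset.univ) (t := τ) (f := m) (by rw [Finset.card_univ]; omega) (fun i _ => hmτ i)
    exact ⟨k, k', h, h'⟩
  let M : ι → Finset T := fun k => Finset.univ.filter fun y => ∀ j, j ≠ k → r j (m j) < r j y
  have hMmem : ∀ k y, y ∈ M k ↔ ∀ j, j ≠ k → r j (m j) < r j y := fun k y => by simp [M]
  have hMne : ∀ k, (M k).Nonempty := fun k => by
    obtain ⟨y, hy⟩ := hM k
    refine ⟨y, (hMmem k y).2 fun j hj => ?_⟩
    obtain ⟨z, hz, h⟩ := hy j hj
    exact (hm j z hz).trans_lt h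
  choose w hwM hw using fun k => (M k).exists_max_image (r k) (hMne k)
  have hle : ∀ k y, y ∈ M k → r k y ≤ r k (m k) := fun k y hy => by
    obtain ⟨i, hi⟩ := hτ y
    by_cases hik : i = k
    · subst hik; exact hi _ (hmτ i)
    · exact absurd (hi _ (hmτ i)) (not_le.2 ((hMmem k y).1 hy i hik))
  have hfwd : ∀ a b, a ≠ b → m a = m b → w a ∉ τ ∧ IsDominant r (insert (w a) τ) := by
    intro a b hab hmab
    refine ⟨fun hmem => ?_, fun y => ?_⟩
    · have h1 : w a = m a := hr a (le_antisymm (hle a _ (hwM a)) (hm a _ hmem))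
      have h2 := (hMmem a _).1 (hwM a) b hab.symm
      rw [h1, hmab] at h2
      exact lt_irrefl _ h2
    · by_cases hy : y ∈ M a
      · refine ⟨a, fun x hx => ?_⟩
        rcases Finset.mem_insert.1 hx with rfl | hx
        · exact hw a y hy
        · exact (hle a y hy).trans (hm a x hx)
      · rw [hMmem] at hy
        push Not at hy
        obtain ⟨j, hj, hyj⟩ := hy
        refine ⟨j, fun x hx => ?_⟩
        rcases Finset.mem_insert.1 hx with rfl | hx
        · exact hyj.trans ((hMmem a _).1 (hwM a) j hj).le
        · exact hyj.trans (hm j x hx)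
  have hbwd : ∀ x, x ∉ τ → IsDominant r (insert x τ) → x = w k ∨ x = w k' := by
    intro x hx hdom
    obtain ⟨k₀, hk₀⟩ := hdom x
    have hsurj₀ : ∀ z ∈ τ, ∃ i, i ≠ k₀ ∧ m i = z := fun z hz => by
      obtain ⟨i, hi⟩ := hdom z
      refine ⟨i, ?_, hr i (le_antisymm (hm i z hz) (hi _ (Finset.mem_insert_of_mem (hmτ i))))⟩
      rintro rfl
      have := hr i (le_antisymm (hk₀ z (Finset.mem_insert_of_mem hz))
        (hi x (Finset.mem_insert_self _ _)))
      exact hx (this ▸ hz)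
    have hinj₀ := hinj k₀ hsurj₀
    have hxM : x ∈ M k₀ := (hMmem _ _).2 fun j hj => by
      obtain ⟨i, hi⟩ := hdom (m j)
      have hij : m i = m j :=
        hr i (le_antisymm (hm i _ (hmτ j)) (hi _ (Finset.mem_insert_of_mem (hmτ i))))
      have hik : i ≠ k₀ := by
        rintro rfl
        have := hr i (le_antisymm (hk₀ (m j) (Finset.mem_insert_of_mem (hmτ j)))
          (hi x (Finset.mem_insert_self _ _)))
        exact hx (this ▸ hmτ j)
      obtain rfl := hinj₀ i j hik hj hij
      refine lt_of_le_of_ne (hi x (Finset.mem_insert_self _ _)) fun h => hx ?_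
      rw [← hr i h]; exact hmτ i
    have hxw : x = w k₀ := by
      refine hr k₀ (le_antisymm (hw k₀ x hxM) ?_)
      obtain ⟨i, hi⟩ := hdom (w k₀)
      by_cases hik : i = k₀
      · subst hik; exact hi x (Finset.mem_insert_self _ _)
      · exact absurd (hi _ (Finset.mem_insert_of_mem (hmτ i)))
          (not_le.2 ((hMmem _ _).1 (hwM k₀) i hik))
    by_cases h1 : k = k₀
    · exact Or.inl (h1 ▸ hxw)
    by_cases h2 : k' = k₀
    · exact Or.inr (h2 ▸ hxw)
    exact absurd (hinj₀ k k' h1 h2 hmk) hkk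
  have hne' : w k ≠ w k' := fun h => by
    have h1 := (hMmem k _).1 (hwM k) k' hkk.symm
    rw [h] at h1
    exact absurd (hle k' _ (hwM k')) (not_le.2 h1)
  have : (Finset.univ.filter fun x => x ∉ τ ∧ IsDominant r (insert x τ)) = {w k, w k'} := by
    ext x
    simp only [Finset.mem_filter, Finset.mem_univ, true_and, Finset.mem_insert,
      Finset.mem_singleton]
    constructor
    · rintro ⟨h, h'⟩; exact hbwd x h h'
    · rintro (rfl | rfl)
      · exact hfwd k k' hkk hmk
      · exact hfwd k' k hkk.symm hmk.symm
  rw [this, Finset.card_pair hne']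

/-- In the setting of Scarf's lemma, the set `e '' (ι \ {i₀})` has a single completion: the greatest
element of `T` for the order `i₀` among those outside the range of `e`. -/
theorem card_completions_image_erase [Fintype T] [DecidableEq T] [Fintype ι] [DecidableEq ι]
    {r : ι → T → α} (hr : ∀ i, Function.Injective (r i)) {e : ι → T}
    (hmin : ∀ i y, r i (e i) ≤ r i y)
    (hmax : ∀ i j, i ≠ j → ∀ y, y ∉ Set.range e → r i y < r i (e j))
    (hT : ∃ y, y ∉ Set.range e) (i₀ : ι)
    [DecidablePred fun x => x ∉ (Finset.univ.erase i₀).image e ∧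
      IsDominant r (insert x ((Finset.univ.erase i₀).image e))] :
    (Finset.univ.filter fun x => x ∉ (Finset.univ.erase i₀).image e ∧
      IsDominant r (insert x ((Finset.univ.erase i₀).image e))).card = 1 := by
  classical
  set τ := (Finset.univ.erase i₀).image e with hτ
  have hmemτ : ∀ j, j ≠ i₀ → e j ∈ τ := fun j hj =>
    Finset.mem_image_of_mem e (by simpa using hj)
  have hτe : ∀ z ∈ τ, ∃ j, j ≠ i₀ ∧ e j = z := fun z hz => by
    simpa [hτ] using hz
  let G : Finset T := Finset.univ.filter fun y => y ∉ Set.range e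
  have hG : ∀ y, y ∈ G ↔ y ∉ Set.range e := fun y => by simp [G]
  have hlt : ∀ i y, y ∉ Set.range e → r i (e i) < r i y := fun i y hy =>
    lt_of_le_of_ne (hmin i y) fun h => hy ⟨i, hr i h⟩
  obtain ⟨w, hwG, hw⟩ := G.exists_max_image (r i₀) (hT.imp fun y hy => (hG y).2 hy)
  rw [Finset.card_eq_one]
  refine ⟨w, ?_⟩
  ext x
  simp only [Finset.mem_filter, Finset.mem_univ, true_and, Finset.mem_singleton]
  constructor
  · rintro ⟨hx, hdom⟩
    have key : ∀ y, y ∉ Set.range e → r i₀ y ≤ r i₀ x := fun y hy => by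
      obtain ⟨i, hi⟩ := hdom y
      by_cases hii : i = i₀
      · subst hii; exact hi x (Finset.mem_insert_self _ _)
      · exact absurd (hi _ (Finset.mem_insert_of_mem (hmemτ i hii))) (not_le.2 (hlt i y hy))
    have hxe : x ∉ Set.range e := by
      rintro ⟨j, rfl⟩
      by_cases hj : j = i₀
      · subst hj
        obtain ⟨y, hy⟩ := hT
        exact absurd (key y hy) (not_le.2 (hlt j y hy))
      · exact hx (hmemτ j hj)
    exact hr i₀ (le_antisymm (hw x ((hG x).2 hxe)) (key w ((hG w).1 hwG)))
  · rintro rfl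
    have hxe := (hG x).1 hwG
    refine ⟨fun h => ?_, fun y => ?_⟩
    · obtain ⟨j, -, rfl⟩ := hτe x h
      exact hxe ⟨j, rfl⟩
    · by_cases hy : y ∈ Set.range e
      · obtain ⟨j, rfl⟩ := hy
        exact ⟨j, fun z _ => hmin j z⟩
      · refine ⟨i₀, fun z hz => ?_⟩
        rcases Finset.mem_insert.1 hz with rfl | hz
        · exact hw y ((hG y).2 hy)
        · obtain ⟨j, hj, rfl⟩ := hτe z hz
          exact (hmax i₀ j hj.symm y hy).le

/-- A set of as many elements as there are colours, not all of which occur in it, has an even number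
of subsets on which the colouring is a bijection onto the colours other than `i₀`. -/
theorem even_card_bicolored_facets [DecidableEq T] [Fintype ι] [DecidableEq ι]
    (c : T → ι) (i₀ : ι) (D : Finset (Finset T)) (σ : Finset T)
    (hD : ∀ τ ⊆ σ, τ ∈ D ↔ τ.image c = Finset.univ.erase i₀ ∧ τ.card + 1 = Fintype.card ι)
    (hσ : σ.card = Fintype.card ι) (hc : ∃ i, ∀ x ∈ σ, c x ≠ i) :
    Even (D.filter fun τ => τ ⊆ σ).card := by
  classical
  rcases (D.filter fun τ => τ ⊆ σ).eq_empty_or_nonempty with h | ⟨τ, hτ⟩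
  · simp [h]
  obtain ⟨hτD, hτσ⟩ := Finset.mem_filter.1 hτ
  obtain ⟨himg, hcard⟩ := (hD τ hτσ).1 hτD
  have hinjOn : ∀ τ ⊆ σ, τ ∈ D → Set.InjOn c τ := fun τ hs h => by
    obtain ⟨h1, h2⟩ := (hD τ hs).1 h
    refine Finset.card_image_iff.mp ?_
    rw [h1, Finset.card_erase_of_mem (Finset.mem_univ _), Finset.card_univ]; omega
  obtain ⟨x, hxσ, hxτ⟩ : ∃ x ∈ σ, x ∉ τ := by
    by_contra! h
    have := Finset.card_le_card (show σ ⊆ τ from h)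
    omega
  have hins : insert x τ = σ := by
    refine Finset.eq_of_subset_of_card_le (Finset.insert_subset hxσ hτσ) ?_
    rw [Finset.card_insert_of_notMem hxτ]; omega
  have hcx : c x ≠ i₀ := by
    rintro hx
    obtain ⟨i, hi⟩ := hc
    have hne : i ≠ i₀ := fun h => hi x hxσ (hx.trans h.symm)
    have : i ∈ τ.image c := by rw [himg]; simpa using hne
    obtain ⟨z, hz, hzi⟩ := Finset.mem_image.1 this
    exact hi z (hτσ hz) hzi
  obtain ⟨x', hx'τ, hx'⟩ : ∃ x' ∈ τ, c x' = c x := by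
    have : c x ∈ τ.image c := by rw [himg]; simpa using hcx
    exact Finset.mem_image.1 this
  have hxx : x ≠ x' := fun h => hxτ (h ▸ hx'τ)
  have hx'σ := hτσ hx'τ
  have hD' : ∀ z ∈ σ, c z = c x → σ.erase z ∈ D := fun z hz hzx => by
    refine (hD _ (Finset.erase_subset _ _)).2 ⟨?_, by rw [Finset.card_erase_of_mem hz]; omega⟩
    rw [← himg]
    ext i
    simp only [Finset.mem_image, Finset.mem_erase]
    constructor
    · rintro ⟨u, ⟨-, hu⟩, rfl⟩
      rw [← hins] at hu
      rcases Finset.mem_insert.1 hu with rfl | hu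
      · exact ⟨x', hx'τ, hx'⟩
      · exact ⟨u, hu, rfl⟩
    · rintro ⟨u, hu, rfl⟩
      by_cases huz : u = z
      · subst huz
        exact ⟨x, ⟨fun h => hxτ (h ▸ hu), hxσ⟩, hzx.symm⟩
      · exact ⟨u, ⟨huz, hτσ hu⟩, rfl⟩
  have : (D.filter fun τ => τ ⊆ σ) = {σ.erase x, σ.erase x'} := by
    ext ρ
    simp only [Finset.mem_filter, Finset.mem_insert, Finset.mem_singleton]
    constructor
    · rintro ⟨hρD, hρσ⟩
      have hρ := ((hD ρ hρσ).1 hρD).2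
      by_cases h1 : x ∈ ρ
      · by_cases h2 : x' ∈ ρ
        · exact absurd (hinjOn ρ hρσ hρD h1 h2 hx'.symm) hxx
        · right
          exact Finset.eq_of_subset_of_card_le (Finset.subset_erase.2 ⟨hρσ, h2⟩)
            (by rw [Finset.card_erase_of_mem hx'σ]; omega)
      · left
        exact Finset.eq_of_subset_of_card_le (Finset.subset_erase.2 ⟨hρσ, h1⟩)
          (by rw [Finset.card_erase_of_mem hxσ]; omega)
    · rintro (rfl | rfl)
      · exact ⟨hD' x hxσ rfl, Finset.erase_subset _ _⟩
      · exact ⟨hD' x' hx'σ hx', Finset.erase_subset _ _⟩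
  rw [this, Finset.card_pair]
  · exact even_two
  · intro h
    have : x' ∈ σ.erase x := Finset.mem_erase.2 ⟨hxx.symm, hx'σ⟩
    rw [h] at this
    exact Finset.notMem_erase _ _ this

/-- **Scarf's lemma**, with boundary elements: for each index `i` there is an element `e i` of colour
`i` which is the minimum for the order `i` and which lies, for the other orders, above all elements
outside the range of `e`. Then some dominant set carries all colours. The proof is a double count,
modulo 2, of the inclusions of the dominant sets having all colours but `i₀` in the dominant sets
having one element more. -/
theorem exists_isDominant_forall_color [Fintype T] [Fintype ι] [Nonempty ι]
    {r : ι → T → α} (hr : ∀ i, Function.Injective (r i)) {e : ι → T}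
    (hmin : ∀ i y, r i (e i) ≤ r i y)
    (hmax : ∀ i j, i ≠ j → ∀ y, y ∉ Set.range e → r i y < r i (e j))
    (hT : ∃ y, y ∉ Set.range e) (c : T → ι) (hce : ∀ i, c (e i) = i) :
    ∃ σ, IsDominant r σ ∧ ∀ i, ∃ x ∈ σ, c x = i := by
  classical
  by_contra! hno
  obtain ⟨i₀⟩ := ‹Nonempty ι›
  let S : Finset (Finset T) :=
    Finset.univ.filter fun σ => σ.card = Fintype.card ι ∧ IsDominant r σ
  let D : Finset (Finset T) := Finset.univ.filter fun τ =>
    (τ.image c = Finset.univ.erase i₀ ∧ τ.card + 1 = Fintype.card ι) ∧ IsDominant r τ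
  have hS : ∀ σ, σ ∈ S ↔ σ.card = Fintype.card ι ∧ IsDominant r σ := fun σ => by simp [S]
  have hD : ∀ τ, τ ∈ D ↔ (τ.image c = Finset.univ.erase i₀ ∧ τ.card + 1 = Fintype.card ι) ∧
      IsDominant r τ := fun σ => by simp [D]
  have hdouble := Finset.sum_card_bipartiteAbove_eq_sum_card_bipartiteBelow
    (s := D) (t := S) (fun τ σ : Finset T => τ ⊆ σ)
  have heven : Even (∑ σ ∈ S, (D.bipartiteBelow (fun τ σ : Finset T => τ ⊆ σ) σ).card) := by
    refine Finset.even_sum _ fun σ hσ => ?_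
    obtain ⟨hσc, hσd⟩ := (hS σ).1 hσ
    exact even_card_bicolored_facets c i₀ D σ
      (fun τ hτ => (hD τ).trans (and_iff_left (hσd.mono hτ))) hσc (hno σ hσd)
  have habove : ∀ τ ∈ D, (S.bipartiteAbove (fun τ σ : Finset T => τ ⊆ σ) τ).card =
      (Finset.univ.filter fun x => x ∉ τ ∧ IsDominant r (insert x τ)).card := by
    intro τ hτ
    obtain ⟨⟨-, hτc⟩, -⟩ := (hD τ).1 hτ
    symm
    refine Finset.card_bij (fun x _ => insert x τ) ?_ ?_ ?_
    · intro x hx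
      simp only [Finset.mem_filter, Finset.mem_univ, true_and] at hx
      refine Finset.mem_filter.2 ⟨(hS _).2 ⟨?_, hx.2⟩, Finset.subset_insert _ _⟩
      rw [Finset.card_insert_of_notMem hx.1, hτc]
    · intro x hx y hy hxy
      simp only [Finset.mem_filter, Finset.mem_univ, true_and] at hx hy
      have : x ∈ insert y τ := hxy ▸ Finset.mem_insert_self x τ
      exact (Finset.mem_insert.1 this).resolve_right hx.1
    · intro σ hσ
      obtain ⟨hσS, hτσ⟩ := Finset.mem_filter.1 hσ
      obtain ⟨hσc, hσd⟩ := (hS σ).1 hσS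
      obtain ⟨x, hx⟩ : ∃ x, σ \ τ = {x} := by
        rw [← Finset.card_eq_one, Finset.card_sdiff_of_subset hτσ]; omega
      have hxτ : x ∈ σ \ τ := hx ▸ Finset.mem_singleton_self x
      have hins : insert x τ = σ := by
        rw [Finset.insert_eq, ← hx, Finset.sdiff_union_of_subset hτσ]
      exact ⟨x, by simpa [hins] using ⟨(Finset.mem_sdiff.1 hxτ).2, hσd⟩, hins⟩
  let τ₀ : Finset T := (Finset.univ.erase i₀).image e
  have heinj : Function.Injective e := Function.LeftInverse.injective hce
  have hτ₀ : τ₀ ∈ D := by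
    refine (hD _).2 ⟨⟨?_, ?_⟩, fun y => ?_⟩
    · ext i
      simp only [τ₀, Finset.mem_image, Finset.mem_erase, Finset.mem_univ, and_true]
      constructor
      · rintro ⟨_, ⟨j, hj, rfl⟩, rfl⟩; rwa [hce]
      · exact fun h => ⟨e i, ⟨i, h, rfl⟩, hce i⟩
    · rw [Finset.card_image_of_injective _ heinj, Finset.card_erase_of_mem (Finset.mem_univ _),
        Finset.card_univ]
      have := Fintype.card_pos_iff.2 ⟨i₀⟩
      omega
    · by_cases hy : y ∈ Set.range e
      · obtain ⟨j, rfl⟩ := hy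
        exact ⟨j, fun z _ => hmin j z⟩
      · refine ⟨i₀, fun z hz => ?_⟩
        obtain ⟨j, hj, rfl⟩ : ∃ j, j ≠ i₀ ∧ e j = z := by simpa [τ₀] using hz
        exact (hmax i₀ j hj.symm y hy).le
  have hrest : Even (∑ τ ∈ D.erase τ₀,
      (S.bipartiteAbove (fun τ σ : Finset T => τ ⊆ σ) τ).card) := by
    refine Finset.even_sum _ fun τ hτ => ?_
    obtain ⟨hne, hτD⟩ := Finset.mem_erase.1 hτ
    obtain ⟨⟨himg, hτc⟩, hτd⟩ := (hD τ).1 hτD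
    -- The only member of `D` consisting of boundary elements is `τ₀`.
    obtain ⟨g, hgτ, hg⟩ : ∃ g ∈ τ, g ∉ Set.range e := by
      by_contra! hall
      refine hne (Finset.eq_of_subset_of_card_le (fun z hz => ?_) ?_)
      · obtain ⟨j, rfl⟩ := hall z hz
        have : c (e j) ∈ τ.image c := Finset.mem_image_of_mem c hz
        rw [himg, hce] at this
        exact Finset.mem_image_of_mem e this
      · have := ((hD _).1 hτ₀).1.2
        omega
    rw [habove τ hτD, hτd.card_completions_eq_two hr ⟨g, hgτ⟩ hτc]
    · exact even_two
    · intro k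
      refine ⟨e k, fun j hj => ⟨g, hgτ, hmax j k hj g hg⟩⟩
  have hodd : Odd (∑ τ ∈ D, (S.bipartiteAbove (fun τ σ : Finset T => τ ⊆ σ) τ).card) := by
    rw [← Finset.add_sum_erase D _ hτ₀, habove τ₀ hτ₀,
      card_completions_image_erase hr hmin hmax hT i₀]
    exact odd_one.add_even hrest
  rw [hdouble] at hodd
  exact (Nat.not_even_iff_odd.2 hodd) heven

end Scarf

/-! ### Colourings of lattice points of a dilated simplex -/

/-- A Sperner-type lemma without boundary condition. For every colouring of the lattice points of the
`N`-fold dilated simplex there are a face `C` and a lattice point near this face that is near to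
points of each colour in `C`. Scarf's lemma is applied to the coordinate orders with ties broken
arbitrarily, and to boundary elements with `i`-th coordinate below and all others above those of the
lattice points; `C` consists of the indices whose boundary element is not used. -/
theorem exists_lattice_point_near_colors {ι : Type*} [Fintype ι] [Nonempty ι] (N : ℕ)
    (c : (ι → ℕ) → ι) :
    ∃ (C : Finset ι) (v : ι → ℕ), ∑ i, v i = N ∧ (∀ i, i ∉ C → v i ≤ Fintype.card ι) ∧
      ∀ i ∈ C, ∃ v' : ι → ℕ, ∑ i, v' i = N ∧ c v' = i ∧
        ∀ j, v j ≤ v' j + Fintype.card ι ∧ v' j ≤ v j + Fintype.card ι := by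
  classical
  let G := {v : ι → ℕ // v ∈ Finset.piAntidiag Finset.univ N}
  let _ : Fintype G := Finset.fintypeCoeSort (Finset.piAntidiag Finset.univ N)
  have hG : ∀ g : G, ∑ i, g.1 i = N := fun g => (Finset.mem_piAntidiag.1 g.2).1
  have hmk : ∀ v : ι → ℕ, ∑ i, v i = N → v ∈ Finset.piAntidiag Finset.univ N := fun v hv =>
    Finset.mem_piAntidiag.2 ⟨hv, fun i _ => Finset.mem_univ i⟩
  have hGle : ∀ (g : G) i, g.1 i ≤ N := fun g i =>
    (Finset.single_le_sum (fun _ _ => Nat.zero_le _) (Finset.mem_univ i)).trans (hG g).le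
  let val : ι → G ⊕ ι → ℕ := fun i =>
    Sum.elim (fun g => g.1 i + 1) (fun j => if i = j then 0 else N + 2)
  let r : ι → G ⊕ ι → ℕ ×ₗ ℕ := fun i x => toLex (val i x, (Fintype.equivFin (G ⊕ ι) x : ℕ))
  have hr : ∀ i, Function.Injective (r i) := fun i x y hxy => by
    have h : (val i x, (Fintype.equivFin (G ⊕ ι) x : ℕ)) = (val i y, _) := toLex.injective hxy
    exact (Fintype.equivFin (G ⊕ ι)).injective (Fin.ext (Prod.ext_iff.1 h).2)
  have hrlt : ∀ i x y, val i x < val i y → r i x < r i y := fun i x y h =>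
    Prod.Lex.toLex_lt_toLex.2 (Or.inl h)
  have hrle : ∀ i x y, r i x ≤ r i y → val i x ≤ val i y := fun i x y h => by
    by_contra! h'
    exact absurd h (not_le.2 (hrlt i y x h'))
  have hmin : ∀ i y, r i (Sum.inr i) ≤ r i y := by
    rintro i (g | j)
    · exact (hrlt _ _ _ (by simp [val])).le
    · by_cases hij : i = j
      · subst hij; exact le_rfl
      · exact (hrlt _ _ _ (by simp [val, hij])).le
  have hrange : ∀ y : G ⊕ ι, y ∉ Set.range (Sum.inr : ι → G ⊕ ι) → ∃ g, y = Sum.inl g := by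
    rintro (g | j) hy
    · exact ⟨g, rfl⟩
    · exact absurd ⟨j, rfl⟩ hy
  have hmax : ∀ i j, i ≠ j → ∀ y, y ∉ Set.range (Sum.inr : ι → G ⊕ ι) →
      r i y < r i (Sum.inr j) := by
    intro i j hij y hy
    obtain ⟨g, rfl⟩ := hrange y hy
    refine hrlt _ _ _ ?_
    have := hGle g i
    simp only [val, Sum.elim_inl, Sum.elim_inr, if_neg hij]
    omega
  have i₀ : ι := Classical.arbitrary ι
  let g₀ : G := ⟨Pi.single i₀ N, hmk _ (by simp)⟩
  obtain ⟨σ, hdom, hcol⟩ := exists_isDominant_forall_color hr (e := Sum.inr) hmin hmax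
    ⟨Sum.inl g₀, by simp⟩ (Sum.elim (fun g => c g.1) id) (fun _ => rfl)
  have hdomG : ∀ y : G, ∃ i, Sum.inr i ∉ σ ∧ ∀ g : G, Sum.inl g ∈ σ → y.1 i ≤ g.1 i := by
    intro y
    obtain ⟨i, hi⟩ := hdom (Sum.inl y)
    refine ⟨i, fun h => ?_, fun g hg => ?_⟩
    · have := hrle _ _ _ (hi _ h)
      simp [val] at this
    · have := hrle _ _ _ (hi _ hg)
      simpa [val] using this
  let C : Finset ι := Finset.univ.filter fun i => Sum.inr i ∉ σ
  have hC : ∀ i, i ∈ C ↔ Sum.inr i ∉ σ := fun i => by simp [C]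
  have hcolC : ∀ i ∈ C, ∃ g : G, Sum.inl g ∈ σ ∧ c g.1 = i := by
    intro i hi
    obtain ⟨g | j, hx, hxi⟩ := hcol i
    · exact ⟨g, hx, hxi⟩
    · obtain rfl : j = i := hxi
      exact absurd hx ((hC j).1 hi)
  let S : Finset G := Finset.univ.filter fun g => Sum.inl g ∈ σ
  have hS : ∀ g, g ∈ S ↔ Sum.inl g ∈ σ := fun g => by simp [S]
  obtain ⟨i₁, hi₁, -⟩ := hdomG g₀
  have hi₁C : i₁ ∈ C := (hC _).2 hi₁
  obtain ⟨g₁, hg₁, -⟩ := hcolC i₁ hi₁C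
  choose p hpS hp using fun i => S.exists_min_image (fun g : G => g.1 i) ⟨g₁, (hS _).2 hg₁⟩
  let b : ι → ℕ := fun i => if i ∈ C then (p i).1 i else 0
  -- Otherwise some lattice point would exceed, in all coordinates from `C`, the minima over `S`.
  have hb : N < ∑ i, b i + C.card := by
    by_contra! hle
    let y : ι → ℕ := fun i => (b i + if i ∈ C then 1 else 0) +
      Pi.single (M := fun _ => ℕ) i₁ (N - (∑ i, b i + C.card)) i
    have hy : ∑ i, y i = N := by
      simp only [y, Finset.sum_add_distrib, Finset.sum_pi_single', Finset.mem_univ, if_true,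
        Finset.sum_boole, Finset.filter_univ_mem, Nat.cast_id]
      omega
    obtain ⟨i, hi, hle'⟩ := hdomG ⟨y, hmk y hy⟩
    have h1 := hle' (p i) ((hS _).1 (hpS i))
    have hiC := (hC i).2 hi
    simp only [y, b, if_pos hiC] at h1
    omega
  have hbd : ∀ g ∈ S, ∀ i, b i ≤ g.1 i ∧ g.1 i ≤ b i + Fintype.card ι := by
    intro g hg
    have hle : ∀ i, b i ≤ g.1 i := fun i => by
      by_cases hi : i ∈ C
      · simpa only [b, if_pos hi] using hp i g hg
      · simp [b, hi]
    refine fun i => ⟨hle i, ?_⟩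
    have h1 : ∑ j, (g.1 j - b j) + ∑ j, b j = N := by
      rw [← Finset.sum_add_distrib]
      exact (Finset.sum_congr rfl fun j _ => Nat.sub_add_cancel (hle j)).trans (hG g)
    have h2 : g.1 i - b i ≤ ∑ j, (g.1 j - b j) :=
      Finset.single_le_sum (f := fun j => g.1 j - b j) (fun _ _ => Nat.zero_le _)
        (Finset.mem_univ i)
    have h3 := Finset.card_le_univ C
    omega
  refine ⟨C, g₁.1, hG g₁, fun i hi => ?_, fun i hi => ?_⟩
  · simpa [b, hi] using (hbd g₁ ((hS _).2 hg₁) i).2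
  · obtain ⟨g, hg, hgi⟩ := hcolC i hi
    refine ⟨g.1, hG g, hgi, fun j => ?_⟩
    have h1 := hbd g₁ ((hS _).2 hg₁) j
    have h2 := hbd g ((hS _).2 hg) j
    omega

/-! ### Face-preserving maps of the simplex -/

/-- A continuous map from the simplex to the hyperplane `∑ yᵢ = 1` which maps each facet `xᵢ = 0`
into the hyperplane `yᵢ = 0` attains every point of the simplex. Lattice points `x` are coloured by
an index `i` with `φ i x ≤ b i`; in the limit of finer lattices this inequality holds, at one
point, both for the indices of the face `C` and, because the point lies in this face, for the
others. -/
theorem exists_eq_of_maps_facets {ι : Type*} [Fintype ι] [Nonempty ι]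
    (φ : ι → stdSimplex ℝ ι → ℝ) (hφ : ∀ i, Continuous (φ i)) (hsum : ∀ x, ∑ i, φ i x = 1)
    (hface : ∀ x i, x.1 i = 0 → φ i x = 0) (b : stdSimplex ℝ ι) :
    ∃ x, ∀ i, φ i x = b.1 i := by
  classical
  have hcolor : ∀ x, ∃ i, φ i x ≤ b.1 i := fun x => by
    obtain ⟨i, -, hi⟩ := Finset.exists_le_of_sum_le (s := Finset.univ) (f := fun i => φ i x)
      (g := b.1) Finset.univ_nonempty (by rw [hsum, b.2.2])
    exact ⟨i, hi⟩
  suffices h : ∃ x, ∀ i, φ i x ≤ b.1 i by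
    obtain ⟨x, hx⟩ := h
    exact ⟨x, fun i => (Finset.sum_eq_sum_iff_of_le fun i _ => hx i).1
      (by rw [hsum, b.2.2]) i (Finset.mem_univ i)⟩
  choose col hcol using hcolor
  let n := Fintype.card ι
  have hstep : ∀ k : ℕ, ∃ C : Finset ι, ∃ x : stdSimplex ℝ ι,
      (∀ i ∉ C, x.1 i ≤ n / (k + 1)) ∧
      ∀ i ∈ C, ∃ x' : stdSimplex ℝ ι, φ i x' ≤ b.1 i ∧ dist x' x ≤ n / (k + 1) := by
    intro k
    have hk : (0 : ℝ) < k + 1 := by positivity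
    have hpt : ∀ v : ι → ℕ, ∑ i, v i = k + 1 →
        (fun i => (v i : ℝ) / (k + 1)) ∈ stdSimplex ℝ ι := fun v hv => by
      refine ⟨fun i => by positivity, ?_⟩
      rw [← Finset.sum_div, ← Nat.cast_sum, hv]
      push_cast
      exact div_self hk.ne'
    obtain ⟨C, v, hv, hvC, hC⟩ := exists_lattice_point_near_colors (k + 1) fun v =>
      if hv : ∑ i, v i = k + 1 then col ⟨_, hpt v hv⟩ else Classical.arbitrary ι
    refine ⟨C, ⟨_, hpt v hv⟩, fun i hi => ?_, fun i hi => ?_⟩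
    · have := hvC i hi
      change (v i : ℝ) / (k + 1) ≤ n / (k + 1)
      gcongr
    · obtain ⟨v', hv', hci, hdist⟩ := hC i hi
      rw [dif_pos hv'] at hci
      refine ⟨⟨_, hpt v' hv'⟩, hci ▸ hcol _, ?_⟩
      rw [Subtype.dist_eq, dist_pi_le_iff (by positivity)]
      intro j
      rw [Real.dist_eq, ← sub_div, abs_div, abs_of_pos hk]
      gcongr
      have h1 : (v j : ℝ) ≤ v' j + n := by exact_mod_cast (hdist j).1
      have h2 : (v' j : ℝ) ≤ v j + n := by exact_mod_cast (hdist j).2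
      rw [abs_le]
      constructor <;> linarith
  choose C x hxC hx using hstep
  -- Along an ultrafilter the face is constant and the points converge.
  let U := Filter.hyperfilter ℕ
  obtain ⟨C₀, hC₀⟩ : ∃ C₀, ∀ᶠ k in U, C k = C₀ :=
    Ultrafilter.eventually_exists_iff.1 (Filter.Eventually.of_forall fun k => ⟨C k, rfl⟩)
  obtain ⟨x₀, -, hx₀⟩ := isCompact_univ.ultrafilter_le_nhds (U.map x) (by simp)
  have hx₀ : Filter.Tendsto x U (nhds x₀) := hx₀
  have hU : (U : Filter ℕ) ≤ Filter.atTop := by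
    rw [← Nat.cofinite_eq_atTop]; exact Filter.hyperfilter_le_cofinite
  have hlim : Filter.Tendsto (fun k : ℕ => (n : ℝ) / (k + 1)) U (nhds 0) :=
    (tendsto_const_div_atTop_nhds_zero_nat (n : ℝ)).comp
      (Filter.tendsto_add_atTop_nat 1) |>.congr (fun k => by simp) |>.mono_left hU
  have hcoord : ∀ i, Filter.Tendsto (fun k => (x k).1 i) U (nhds (x₀.1 i)) := fun i =>
    (((continuous_apply i).comp continuous_subtype_val).tendsto x₀).comp hx₀
  refine ⟨x₀, fun i => ?_⟩
  by_cases hi : i ∈ C₀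
  · have hex : ∀ k, ∃ x', C k = C₀ → φ i x' ≤ b.1 i ∧ dist x' (x k) ≤ n / (k + 1) := fun k => by
      by_cases h : C k = C₀
      · obtain ⟨x', h'⟩ := hx k i (h ▸ hi)
        exact ⟨x', fun _ => h'⟩
      · exact ⟨x₀, fun h' => absurd h' h⟩
    choose x' hx' using hex
    have hd : Filter.Tendsto (fun k => dist (x' k) (x k)) U (nhds 0) :=
      squeeze_zero' (Filter.Eventually.of_forall fun _ => dist_nonneg)
        (hC₀.mono fun k hk => (hx' k hk).2) hlim
    have hx'₀ : Filter.Tendsto x' U (nhds x₀) := by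
      rw [tendsto_iff_dist_tendsto_zero] at hx₀ ⊢
      refine squeeze_zero (fun _ => dist_nonneg) (fun k => dist_triangle (x' k) (x k) x₀) ?_
      simpa using hd.add hx₀
    exact le_of_tendsto (((hφ i).tendsto x₀).comp hx'₀) (hC₀.mono fun k hk => (hx' k hk).1)
  · have h0 : x₀.1 i ≤ 0 :=
      le_of_tendsto_of_tendsto (hcoord i) hlim (hC₀.mono fun k hk => hxC k i (hk ▸ hi))
    rw [hface x₀ i (le_antisymm h0 (x₀.2.1 i))]
    exact b.2.1 i

/-! ### Envy-free assignments with one piece left over -/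

/-- Nonnegative weights with row sums `1` and column sums `card ι / card κ < 1` admit, after deletion
of any column, a choice of distinct columns carrying positive weight: a nonempty set `A` of rows
has its total weight `card A` in more than `card A` columns, so Hall's theorem applies. -/
theorem exists_injective_pos_of_sum_eq {ι κ : Type*} [Fintype ι] [Fintype κ]
    (hcard : Fintype.card κ = Fintype.card ι + 1) (w : ι → κ → ℝ) (hw : ∀ i j, 0 ≤ w i j)
    (hrow : ∀ i, ∑ j, w i j = 1) (hcol : ∀ j, ∑ i, w i j = Fintype.card ι / Fintype.card κ)
    (j₀ : κ) : ∃ m : ι → κ, Function.Injective m ∧ ∀ i, m i ≠ j₀ ∧ 0 < w i (m i) := by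
  classical
  refine (Fintype.all_card_le_filter_rel_iff_exists_injective
    fun i j => j ≠ j₀ ∧ 0 < w i j).1 fun A => ?_
  rcases A.eq_empty_or_nonempty with rfl | hA
  · simp
  let B : Finset κ := Finset.univ.filter fun j => ∃ a ∈ A, 0 < w a j
  have hle : (A.card : ℝ) ≤ B.card * (Fintype.card ι / Fintype.card κ) := by
    calc (A.card : ℝ) = ∑ a ∈ A, ∑ j ∈ B, w a j := by
          rw [Finset.card_eq_sum_ones, Nat.cast_sum]
          refine Finset.sum_congr rfl fun a ha => ?_
          rw [Nat.cast_one, ← hrow a]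
          refine (Finset.sum_subset (Finset.subset_univ B) fun j _ hj => ?_).symm
          by_contra h
          exact hj (Finset.mem_filter.2 ⟨Finset.mem_univ j, a, ha, (hw a j).lt_of_ne' h⟩)
      _ = ∑ j ∈ B, ∑ a ∈ A, w a j := Finset.sum_comm
      _ ≤ ∑ j ∈ B, ∑ i, w i j := Finset.sum_le_sum fun j _ =>
          Finset.sum_le_sum_of_subset_of_nonneg (Finset.subset_univ A) fun i _ _ => hw i j
      _ = B.card * (Fintype.card ι / Fintype.card κ) := by
          simp only [hcol, Finset.sum_const, nsmul_eq_mul]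
  have hle' : A.card * (Fintype.card ι + 1) ≤ B.card * Fintype.card ι := by
    rw [hcard, Nat.cast_add, Nat.cast_one, ← mul_div_assoc, le_div_iff₀ (by positivity)] at hle
    exact_mod_cast hle
  have hlt : A.card < B.card := by
    by_contra! h
    have h1 := Nat.mul_le_mul_right (Fintype.card ι) h
    have h2 := hA.card_pos
    rw [Nat.mul_add] at hle'
    omega
  have hsub : B.erase j₀ ⊆ Finset.univ.filter fun j => ∃ a ∈ A, j ≠ j₀ ∧ 0 < w a j := by
    intro j hj
    obtain ⟨hj₀, hjB⟩ := Finset.mem_erase.1 hj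
    obtain ⟨a, ha, haj⟩ := (Finset.mem_filter.1 hjB).2
    exact Finset.mem_filter.2 ⟨Finset.mem_univ j, a, ha, hj₀, haj⟩
  have h1 := Finset.card_le_card hsub
  have h2 := Finset.pred_card_le_card_erase (s := B) (a := j₀)
  omega

/-- The approximate form of `exists_forall_exists_injective_isMax`: the assigned values are maximal
up to a factor `t < 1`. Each `i` spreads a unit weight over the `j` whose value exceeds `t` times the
maximum, continuously in `x`; the average of these weights is a face-preserving map, and `x` is
chosen so that it takes the barycenter as its value. -/
theorem exists_forall_exists_injective_mul_le {ι κ : Type*} [Fintype ι] [Fintype κ] [Nonempty ι]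
    (hcard : Fintype.card κ = Fintype.card ι + 1) (f : ι → κ → stdSimplex ℝ κ → ℝ)
    (hf : ∀ i j, Continuous (f i j)) (hface : ∀ i j x, x.1 j = 0 → f i j x = 0)
    (hpos : ∀ i x, ∃ j, 0 < f i j x) {t : ℝ} (ht₀ : 0 ≤ t) (ht₁ : t < 1) :
    ∃ x, ∀ j₀, ∃ m : ι → κ, Function.Injective m ∧ (∀ i, m i ≠ j₀) ∧
      ∀ i j, t * f i j x ≤ f i (m i) x := by
  classical
  have hκ : 0 < Fintype.card κ := by omega
  have : Nonempty κ := Fintype.card_pos_iff.1 hκ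
  have hι : (0 : ℝ) < Fintype.card ι := by exact_mod_cast Fintype.card_pos
  have hκ' : (0 : ℝ) < Fintype.card κ := by exact_mod_cast hκ
  let M : ι → stdSimplex ℝ κ → ℝ := fun i x =>
    Finset.univ.sup' Finset.univ_nonempty fun j => f i j x
  have hMle : ∀ i j x, f i j x ≤ M i x := fun i j x =>
    Finset.le_sup' (fun j => f i j x) (Finset.mem_univ j)
  have hMpos : ∀ i x, 0 < M i x := fun i x => by
    obtain ⟨j, hj⟩ := hpos i x
    exact hj.trans_le (hMle i j x)
  have hMcont : ∀ i, Continuous (M i) := fun i =>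
    Continuous.finset_sup'_apply Finset.univ_nonempty fun j _ => hf i j
  let u : ι → κ → stdSimplex ℝ κ → ℝ := fun i j x => max (f i j x - t * M i x) 0
  have hu : ∀ i j x, 0 ≤ u i j x := fun i j x => le_max_right _ _
  have hucont : ∀ i j, Continuous (u i j) := fun i j =>
    ((hf i j).sub ((hMcont i).const_mul t)).max continuous_const
  have hW : ∀ i x, 0 < ∑ j, u i j x := fun i x => by
    obtain ⟨j, -, hj⟩ := Finset.exists_mem_eq_sup' Finset.univ_nonempty fun j => f i j x
    refine Finset.sum_pos' (fun j _ => hu i j x) ⟨j, Finset.mem_univ j, lt_max_of_lt_left ?_⟩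
    have hj : M i x = f i j x := hj
    rw [← hj]
    nlinarith [hMpos i x]
  let w : stdSimplex ℝ κ → ι → κ → ℝ := fun x i j => u i j x / ∑ j', u i j' x
  have hrow : ∀ x i, ∑ j, w x i j = 1 := fun x i => by
    simp only [w]
    rw [← Finset.sum_div, div_self (hW i x).ne']
  obtain ⟨x, hx⟩ := exists_eq_of_maps_facets
    (fun j x => (∑ i, w x i j) / Fintype.card ι)
    (fun j => (continuous_finsetSum _ fun i _ => (hucont i j).div
      (continuous_finsetSum _ fun j' _ => hucont i j') fun x => (hW i x).ne').div_const _)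
    (fun x => by
      rw [← Finset.sum_div, Finset.sum_comm]
      simp only [hrow, Finset.sum_const, Finset.card_univ, nsmul_eq_mul, mul_one]
      exact div_self hι.ne')
    (fun x j hj => by
      have : ∀ i, u i j x = 0 := fun i => by
        refine max_eq_right ?_
        rw [hface i j x hj]
        nlinarith [hMpos i x]
      simp [w, this])
    ⟨fun _ => 1 / Fintype.card κ, fun _ => by positivity, by simp [hκ'.ne']⟩
  refine ⟨x, fun j₀ => ?_⟩
  obtain ⟨m, hm, hmw⟩ := exists_injective_pos_of_sum_eq hcard (w x)
    (fun i j => div_nonneg (hu i j x) (hW i x).le) (hrow x)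
    (fun j => by
      have := (div_eq_iff hι.ne').1 (hx j)
      rw [this]; ring) j₀
  refine ⟨m, hm, fun i => (hmw i).1, fun i j => ?_⟩
  have h1 : 0 < u i (m i) x := (div_pos_iff_of_pos_right (hW i x)).1 (hmw i).2
  have h2 : 0 < f i (m i) x - t * M i x := (lt_max_iff.1 h1).resolve_right (lt_irrefl _)
  have h3 := mul_le_mul_of_nonneg_left (hMle i j x) ht₀
  linarith

/-- Let there be one agent fewer than there are pieces, and let the value `f i j x` of piece `j` for
agent `i` be continuous in `x`, zero where `x j = 0`, and positive for some `j`. Then at some `x`,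
whichever piece `j₀` is taken away, the agents can share the others so that each of them receives a
piece of maximal value among all pieces, `j₀` included. -/
theorem exists_forall_exists_injective_isMax {ι κ : Type*} [Fintype ι] [Fintype κ] [Nonempty ι]
    (hcard : Fintype.card κ = Fintype.card ι + 1) (f : ι → κ → stdSimplex ℝ κ → ℝ)
    (hf : ∀ i j, Continuous (f i j)) (hface : ∀ i j x, x.1 j = 0 → f i j x = 0)
    (hpos : ∀ i x, ∃ j, 0 < f i j x) :
    ∃ x, ∀ j₀, ∃ m : ι → κ, Function.Injective m ∧ (∀ i, m i ≠ j₀) ∧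
      ∀ i j, f i j x ≤ f i (m i) x := by
  have hstep : ∀ k : ℕ, ∃ x, ∃ m : κ → ι → κ, ∀ j₀, Function.Injective (m j₀) ∧
      (∀ i, m j₀ i ≠ j₀) ∧ ∀ i j, (1 - 1 / ((k : ℝ) + 1)) * f i j x ≤ f i (m j₀ i) x := by
    intro k
    have hk : (0 : ℝ) < k + 1 := by positivity
    obtain ⟨x, hx⟩ := exists_forall_exists_injective_mul_le hcard f hf hface hpos
      (t := 1 - 1 / ((k : ℝ) + 1))
      (sub_nonneg.2 ((div_le_one hk).2 (le_add_of_nonneg_left k.cast_nonneg)))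
      (sub_lt_self _ (by positivity))
    choose m hm using hx
    exact ⟨x, m, hm⟩
  choose x m hm using hstep
  -- There are finitely many assignments, so along an ultrafilter they do not depend on `k`.
  let U := Filter.hyperfilter ℕ
  obtain ⟨m₀, hm₀⟩ : ∃ m₀, ∀ᶠ k in U, m k = m₀ :=
    Ultrafilter.eventually_exists_iff.1 (Filter.Eventually.of_forall fun k => ⟨m k, rfl⟩)
  obtain ⟨x₀, -, hx₀⟩ := isCompact_univ.ultrafilter_le_nhds (U.map x) (by simp)
  have hx₀ : Filter.Tendsto x U (nhds x₀) := hx₀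
  have hU : (U : Filter ℕ) ≤ Filter.atTop := by
    rw [← Nat.cofinite_eq_atTop]; exact Filter.hyperfilter_le_cofinite
  have hlim : Filter.Tendsto (fun k : ℕ => 1 - 1 / ((k : ℝ) + 1)) U (nhds 1) := by
    simpa using (tendsto_one_div_add_atTop_nhds_zero_nat (𝕜 := ℝ)).mono_left hU |>.const_sub 1
  obtain ⟨k, hk⟩ := hm₀.exists
  refine ⟨x₀, fun j₀ => ⟨m₀ j₀, hk ▸ (hm k j₀).1, hk ▸ (hm k j₀).2.1, fun i j => ?_⟩⟩
  have h1 := hlim.mul (((hf i j).tendsto x₀).comp hx₀)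
  rw [one_mul] at h1
  exact le_of_tendsto_of_tendsto h1 (((hf i (m₀ j₀ i)).tendsto x₀).comp hx₀)
    (hm₀.mono fun k hk => hk ▸ (hm k j₀).2.2 i j)

/-! ### Envy-free partitions -/

/-- A measure without prescribed preferences takes a piece `j₀` that is maximal for it; the remaining
measures share the other pieces. -/
theorem isEnvyFree_of_forall_exists_injective {d n : ℕ}
    {C : Fin (n + 1) → Set (EuclideanSpace ℝ (Fin d))}
    {μ : Fin (n + 1) → Measure (EuclideanSpace ℝ (Fin d))}
    (h : ∀ j₀, ∃ m : Fin n → Fin (n + 1), Function.Injective m ∧ (∀ i, m i ≠ j₀) ∧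
      ∀ i j, μ i.castSucc (C j) ≤ μ i.castSucc (C (m i))) :
    IsEnvyFree C μ := by
  obtain ⟨j₀, hj₀⟩ := Finite.exists_max fun j => μ (Fin.last n) (C j)
  obtain ⟨m, hm, hne, hmax⟩ := h j₀
  have hinj : Function.Injective (Fin.snoc m j₀ : Fin (n + 1) → Fin (n + 1)) :=
    Fin.snoc_injective_iff.2 ⟨hm, fun ⟨i, hi⟩ => hne i hi⟩
  refine ⟨Equiv.ofBijective _ (Finite.injective_iff_bijective.1 hinj), fun i i' => ?_⟩
  simp only [Equiv.ofBijective_apply]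
  refine Fin.lastCases ?_ (fun i => ?_) i
  · rw [Fin.snoc_last]; exact hj₀ _
  · rw [Fin.snoc_castSucc]; exact hmax i _

/-- Given a `Δ`-space `B` of partitions of `ℝ^d` into `n` parts and the first `n - 1` measures
(the family `ν`), there is a partition in `B` that is envy-free for `μ_1, …, μ_n`, whatever the
missing measure `μ_n` turns out to be. -/
theorem mainTheorem5 (d n : ℕ) (hd : 0 < d) (hn : 0 < n)
    (B : Set (Fin n → Set (EuclideanSpace ℝ (Fin d)))) (hB : IsDeltaSpace B)
    (ν : Fin (n - 1) → Measure (EuclideanSpace ℝ (Fin d)))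
    (hν_prob : ∀ j, IsProbabilityMeasure (ν j)) (hν_ac : ∀ j, ν j ≪ volume) :
    ∃ C ∈ B, ∀ μ : Fin n → Measure (EuclideanSpace ℝ (Fin d)),
      (∀ j, IsProbabilityMeasure (μ j)) → (∀ j, μ j ≪ volume) →
      (∀ j : Fin (n - 1), μ (Fin.castLE (Nat.sub_le n 1) j) = ν j) →
      IsEnvyFree C μ := by

  obtain ⟨n, rfl⟩ : ∃ m, n = m + 1 := ⟨n - 1, by omega⟩
  change Fin n → Measure (EuclideanSpace ℝ (Fin d)) at ν
  obtain ⟨hpart, R, hRB, hRnull, hRcont⟩ := hB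
  obtain ⟨x, hx⟩ : ∃ x, ∀ j₀, ∃ m : Fin n → Fin (n + 1), Function.Injective m ∧
      (∀ i, m i ≠ j₀) ∧ ∀ i j, (ν i (R x j)).toReal ≤ (ν i (R x (m i))).toReal := by
    rcases Nat.eq_zero_or_pos n with rfl | hn'
    -- With no measures at all, the averages of weights used otherwise are not defined.
    · exact ⟨⟨Pi.single 0 1, single_mem_stdSimplex ℝ 0⟩, fun j₀ =>
        ⟨Fin.elim0, fun i => i.elim0, fun i => i.elim0, fun i => i.elim0⟩⟩
    · have : Nonempty (Fin n) := ⟨⟨0, hn'⟩⟩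
      refine exists_forall_exists_injective_isMax (by simp)
        (fun i j x => (ν i (R x j)).toReal) (fun i j => ?_) (fun i j x hxj => ?_) fun i x => ?_
      · have := hν_prob i
        exact hRcont (ν i) inferInstance (hν_ac i) j
      · simp [hν_ac i (hRnull x j hxj)]
      · have := hν_prob i
        by_contra! h
        have h0 : ∀ j, ν i (R x j) = 0 := fun j =>
          (ENNReal.toReal_eq_zero_iff _).1 (le_antisymm (h j) ENNReal.toReal_nonneg)
            |>.resolve_right (measure_ne_top _ _)
        have h1 := measure_iUnion_null h0
        rw [(hpart _ (hRB x)).iUnion_eq, measure_univ] at h1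
        exact one_ne_zero h1
  refine ⟨R x, hRB x, fun μ _ _ hμν => isEnvyFree_of_forall_exists_injective fun j₀ => ?_⟩
  obtain ⟨m, hm, hne, hmax⟩ := hx j₀
  refine ⟨m, hm, hne, fun i j => ?_⟩
  have hi : μ i.castSucc = ν i := hμν i
  have := hν_prob i
  rw [hi]
  exact (ENNReal.toReal_le_toReal (measure_ne_top _ _) (measure_ne_top _ _)).1 (hmax i j)
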